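/- Let $\kappa>0$, $1<\gamma<3$, $\theta=\frac{\gamma-1}{2}$, $a_\gamma=\frac{2\sqrt{\gamma\kappa}}{\gamma-1}$, and consider $d$ pipelines $x>0$ with cross-sections $A_1,\dots,A_d>0$ meeting at a junction $x=0$, each governed by the isentropic gas equations $$\partial_t\rho_k+\partial_x(\rho_ku_k)=0,\qquad \partial_t(\rho_ku_k)+\partial_x(\rho_ku_k^2+\kappa\rho_k^\gamma)=0 .$$ Let $D=\{(\rho,u):\rho>0\text{ or }\rho=u=0\}$. For $(\rho_l,u_l),(\rho_r,u_r)\in D$ let $\mathcal{RP}(\rho_l,u_l,\rho_r,u_r)(x/t)$ be the self-similar Lax solution (possibly containing vacuum) of the Riemann problem with these left and right states, and let $\mathcal V(\rho_b,u_b)$ be the set of states in $D$ of the form $\mathcal{RP}(\rho_b,u_b,\rho_r,u_r)(0+)$ with $(\rho_r,u_r)\in D$. Write $(\bar\rho_k,\bar u_k)(t)=(\rho_k,u_k)(t,0+)\in D$ for the trace at the junction. A solution of the generalized Riemann problem with constant initial states $(\hat\rho_k,\hat u_k)\in D$ consists of $(\rho_k,u_k):(0,\infty)_t\times(0,\infty)_x\to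 D$ attaining these initial states, such that for some $\rho_*\ge 0$ and all $k$, $(\rho_k,u_k)$ is the restriction to $x>0$ of the Lax solution with left state $(\rho_*,0)$ and right state $(\hat\rho_k,\hat u_k)$, and $\sum_kA_k\bar\rho_k\bar u_k=0$ for a.e. $t>0$. A solution of the generalized Cauchy problem on $[0,T]$, $T\in(0,\infty]$ (on $[0,\infty)$ if $T=\infty$), consists of weak entropy solutions $(\rho_k,\rho_ku_k)\in C([0,T];U_k^0+L^1(0,\infty))$ with values in $D$, where $U^0_k\in D$ are constant states, attaining initial data $(\hat\rho_k,\hat\rho_k\hat u_k)\in U^0_k+L^1(0,\infty)$ with values in $D$, which have traces $(\bar\rho_k,\bar u_k)(t)$ at $x=0+$ for a.e. $t\in(0,T)$ and satisfy, for a.e. $t\in(0,T)$: there is $\rho_*(t)\ge0$ with $(\bar\rho_k,\bar u_k)(t)\in\mathcal V(\rho_*(t),0)$ for all $k$, and $\sum_kA_k\bar\rho_k\bar u_k=0$. Here a weak entropy solution is a distributional solution satisfying $\partial_t\eta_S(\rho,u)+\partial_xG_S(\rho,u)\le0$ in the distributional sense for all convex $S:\mathbb R\to\mathbb R$ for which $\eta_S,G_S$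 are locally integrable along the solution, where $$\eta_S(\rho,u)=\int_{\mathbb R}\chi(\rho,v-u)S(v)\,dv,\quad G_S(\rho,u)=\int_{\mathbb R}[(1-\theta)u+\theta v]\,\chi(\rho,v-u)S(v)\,dv,\quad \chi(\rho,\xi)=c\,(a_\gamma^2\rho^{\gamma-1}-\xi^2)_+^{\frac1{\gamma-1}-\frac12}$$ with $c>0$ normalized such that $\int_{\mathbb R}\chi(\rho,\xi)\,d\xi=\rho$. Let $$G(\rho,u)=\frac{\rho u^3}{2}+\frac{\gamma\kappa}{\gamma-1}\rho^\gamma u,\qquad h(\rho,u)=\frac{u^2}{2}+\frac{\kappa\gamma}{\gamma-1}\rho^{\gamma-1}.$$ **Corollary (non-increasing energy).** Let $(\rho_k,u_k)_{k=1,\dots,d}$ be a solution of the generalized Riemann problem or of the generalized Cauchy problem, with an artificial density $\rho_*$ as above ($\rho_*=\rho_*(t)$ for the Cauchy problem). Then for a.e. $t>0$ (a.e. $t\in(0,T)$ for the Cauchy problem): (i) $\displaystyle\sum_{k=1}^dA_k\,G(\bar\rho_k,\bar u_k)\le0$; (ii) for all $1\le k,l\le d$ with $\bar u_l\le0\le\bar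 u_k$, $$h(\bar\rho_k,\bar u_k)\le h(\rho_*,0)\le h(\bar\rho_l,\bar u_l).$$ -/

import Mathlib

open Set Filter Topology MeasureTheory
open scoped ContDiff

noncomputable section

namespace Gas

/-! States are pairs `s = (ρ, u)` of a density `s.1` and a velocity `s.2`. The pressure law is
`p = κ ρ ^ γ`. -/

/-- The state space: positive density, or vacuum (with the second coordinate `0`). -/
def D : Set (ℝ × ℝ) := {s | 0 < s.1 ∨ (s.1 = 0 ∧ s.2 = 0)}

/-- The conserved quantities `(ρ, ρ u)` of a state `(ρ, u)`. -/
def cons (s : ℝ × ℝ) : ℝ × ℝ := (s.1, s.1 * s.2)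

/-- `θ = (γ - 1) / 2`. -/
def theta (γ : ℝ) : ℝ := (γ - 1) / 2

/-- `a_γ = 2 √(γ κ) / (γ - 1)`. -/
def aConst (κ γ : ℝ) : ℝ := 2 * √(γ * κ) / (γ - 1)

/-- The sound speed `√(κ γ) ρ ^ θ`. -/
def soundSpeed (κ γ ρ : ℝ) : ℝ := √(κ * γ) * ρ ^ theta γ

/-- First Riemann invariant `ω₁ = u - a_γ ρ ^ θ`. -/
def omega1 (κ γ : ℝ) (s : ℝ × ℝ) : ℝ := s.2 - aConst κ γ * s.1 ^ theta γ

/-- Second Riemann invariant `ω₂ = u + a_γ ρ ^ θ`. -/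
def omega2 (κ γ : ℝ) (s : ℝ × ℝ) : ℝ := s.2 + aConst κ γ * s.1 ^ theta γ

/-- First eigenvalue. -/
def lambda1 (κ γ : ℝ) (s : ℝ × ℝ) : ℝ := s.2 - soundSpeed κ γ s.1

/-- Second eigenvalue. -/
def lambda2 (κ γ : ℝ) (s : ℝ × ℝ) : ℝ := s.2 + soundSpeed κ γ s.1

/-! ### Physical energy flux and stagnation enthalpy -/

/-- The physical energy flux `G(ρ, u)`. -/
def energyFlux (κ γ : ℝ) (s : ℝ × ℝ) : ℝ :=
  s.1 * s.2 ^ 3 / 2 + γ * κ / (γ - 1) * s.1 ^ γ * s.2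

/-- The stagnation enthalpy `h(ρ, u)`. -/
def stagnationEnthalpy (κ γ : ℝ) (s : ℝ × ℝ) : ℝ :=
  s.2 ^ 2 / 2 + κ * γ / (γ - 1) * s.1 ^ (γ - 1)

/-! ### Lax wave curves and the self-similar Lax solution of the Riemann problem -/

/-- The velocity jump `√(κ (ρ ^ γ - ρ₀ ^ γ) (ρ - ρ₀) / (ρ ρ₀))` across a shock. -/
def shockJump (κ γ ρ₀ ρ : ℝ) : ℝ :=
  √(κ * (ρ ^ γ - ρ₀ ^ γ) * (ρ - ρ₀) / (ρ * ρ₀))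

/-- The (non-vacuum part of the) forward Lax curve `W₁(ρ₀, u₀)`: the rarefaction curve for
`ρ ≤ ρ₀` and the shock curve for `ρ > ρ₀`. -/
def laxCurve1 (κ γ : ℝ) (s₀ : ℝ × ℝ) : Set (ℝ × ℝ) :=
  {s | 0 < s.1 ∧
    ((s.1 ≤ s₀.1 ∧
        s.2 = s₀.2 + aConst κ γ * s₀.1 ^ theta γ - aConst κ γ * s.1 ^ theta γ) ∨
      (s₀.1 < s.1 ∧ s.2 = s₀.2 - shockJump κ γ s₀.1 s.1))}

/-- The (non-vacuum part of the) forward Lax curve `W₂(ρ₀, u₀)`: the rarefaction curve for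
`ρ ≥ ρ₀` and the shock curve for `ρ < ρ₀`. -/
def laxCurve2 (κ γ : ℝ) (s₀ : ℝ × ℝ) : Set (ℝ × ℝ) :=
  {s | 0 < s.1 ∧
    ((s₀.1 ≤ s.1 ∧
        s.2 = s₀.2 - aConst κ γ * s₀.1 ^ theta γ + aConst κ γ * s.1 ^ theta γ) ∨
      (s.1 < s₀.1 ∧ s.2 = s₀.2 - shockJump κ γ s₀.1 s.1))}

/-- Rankine-Hugoniot speed of a shock between `s` and `s'`. -/
def shockSpeed (s s' : ℝ × ℝ) : ℝ := (s'.1 * s'.2 - s.1 * s.2) / (s'.1 - s.1)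

/-- The state with `ω₂ = w` and `λ₁ = ξ`: the value at `x / t = ξ` in a 1-rarefaction fan. -/
def fan1 (κ γ w ξ : ℝ) : ℝ × ℝ :=
  let ρ := ((w - ξ) / (aConst κ γ + √(κ * γ))) ^ (1 / theta γ)
  (ρ, ξ + soundSpeed κ γ ρ)

/-- The state with `ω₁ = w` and `λ₂ = ξ`: the value at `x / t = ξ` in a 2-rarefaction fan. -/
def fan2 (κ γ w ξ : ℝ) : ℝ × ℝ :=
  let ρ := ((ξ - w) / (aConst κ γ + √(κ * γ))) ^ (1 / theta γ)
  (ρ, ξ - soundSpeed κ γ ρ)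

open Classical in
/-- The 1-wave from `l` to `m ∈ W₁(l)` as a function of `ξ = x / t`. -/
def wave1 (κ γ : ℝ) (l m : ℝ × ℝ) (ξ : ℝ) : ℝ × ℝ :=
  if m.1 ≤ l.1 then
    if ξ ≤ lambda1 κ γ l then l
    else if ξ < lambda1 κ γ m then fan1 κ γ (omega2 κ γ l) ξ
    else m
  else if ξ < shockSpeed l m then l else m

open Classical in
/-- The 2-wave from `m` to `r ∈ W₂(m)` as a function of `ξ = x / t`. -/
def wave2 (κ γ : ℝ) (m r : ℝ × ℝ) (ξ : ℝ) : ℝ × ℝ :=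
  if m.1 ≤ r.1 then
    if ξ ≤ lambda2 κ γ m then m
    else if ξ < lambda2 κ γ r then fan2 κ γ (omega1 κ γ r) ξ
    else r
  else if ξ < shockSpeed m r then m else r

open Classical in
/-- A 1-wave from `l` to `m` followed by a 2-wave from `m` to `r`. The speeds of the 1-wave lie
below the velocity of the middle state `m`, those of the 2-wave above it. -/
def twoWaveProfile (κ γ : ℝ) (l m r : ℝ × ℝ) (ξ : ℝ) : ℝ × ℝ :=
  if ξ < m.2 then wave1 κ γ l m ξ else wave2 κ γ m r ξ

open Classical in
/-- The solution containing vacuum: a complete 1-rarefaction from `l` to vacuum (absent if `l` is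
vacuum), vacuum, and a complete 2-rarefaction from vacuum to `r` (absent if `r` is vacuum). -/
def vacuumProfile (κ γ : ℝ) (l r : ℝ × ℝ) (ξ : ℝ) : ℝ × ℝ :=
  if 0 < l.1 ∧ ξ < omega2 κ γ l then
    if ξ ≤ lambda1 κ γ l then l else fan1 κ γ (omega2 κ γ l) ξ
  else if 0 < r.1 ∧ omega1 κ γ r < ξ then
    if ξ < lambda2 κ γ r then fan2 κ γ (omega1 κ γ r) ξ else r
  else (0, 0)

/-- `W` is the self-similar Lax solution `(t, x) ↦ W (x / t)` of the Riemann problem with left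
state `l` and right state `r`. -/
def IsLaxSolution (κ γ : ℝ) (l r : ℝ × ℝ) (W : ℝ → ℝ × ℝ) : Prop :=
  (0 < l.1 ∧ 0 < r.1 ∧ ∃ m, m ∈ laxCurve1 κ γ l ∧ r ∈ laxCurve2 κ γ m ∧
      W = twoWaveProfile κ γ l m r) ∨
    ((l.1 = 0 ∨ r.1 = 0 ∨ omega2 κ γ l ≤ omega1 κ γ r) ∧ W = vacuumProfile κ γ l r)

/-- The set `V(ρ_b, u_b)` of admissible boundary values: the right-sided traces at `x = 0` of the
Lax solutions of the Riemann problems with left state `b`. -/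
def boundarySet (κ γ : ℝ) (b : ℝ × ℝ) : Set (ℝ × ℝ) :=
  {s | s ∈ D ∧ ∃ r ∈ D, ∃ W, IsLaxSolution κ γ b r W ∧ Tendsto W (𝓝[>] 0) (𝓝 s)}

/-- `s` is the one-sided trace at `0+` of a function defined almost everywhere on `(0, ∞)`; the
limit is an essential limit, taken in the conserved quantities. -/
def HasTrace (f : ℝ → ℝ × ℝ) (s : ℝ × ℝ) : Prop :=
  s ∈ D ∧ Tendsto (fun x => cons (f x)) (𝓝[>] 0 ⊓ ae volume) (𝓝 (cons s))

/-! ### The generalized Riemann problem -/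

/-- `U k t x = (ρ_k, u_k)(t, x)`, `k = 1, …, d`, is a solution of the generalized Riemann problem
with constant initial states `Uhat k`, artificial density `ρs` and traces
`Ubar k t = (ρ_k, u_k)(t, 0+)`. -/
structure IsGeneralizedRiemannSolution (κ γ : ℝ) {d : ℕ} (A : Fin d → ℝ)
    (Uhat : Fin d → ℝ × ℝ) (U : Fin d → ℝ → ℝ → ℝ × ℝ) (ρs : ℝ)
    (Ubar : Fin d → ℝ → ℝ × ℝ) : Prop where
  init_mem : ∀ k, Uhat k ∈ D
  mem : ∀ k, ∀ t > 0, ∀ x > 0, U k t x ∈ D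
  trace : ∀ᵐ t : ℝ, 0 < t → ∀ k, HasTrace (U k t) (Ubar k t)
  /-- initial condition -/
  rp0 : ∀ k, ∀ᵐ x : ℝ, 0 < x →
    Tendsto (fun t => U k t x) (𝓝[>] 0 ⊓ ae volume) (𝓝 (Uhat k))
  density_nonneg : 0 ≤ ρs
  /-- restriction of the Lax solution with left state `(ρs, 0)` and right state `Uhat k` -/
  rp1 : ∀ k, ∃ W, IsLaxSolution κ γ (ρs, 0) (Uhat k) W ∧
    ∀ᵐ p : ℝ × ℝ, 0 < p.1 → 0 < p.2 → U k p.1 p.2 = W (p.2 / p.1)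
  /-- conservation of mass -/
  rp2 : ∀ᵐ t : ℝ, 0 < t → ∑ k, A k * ((Ubar k t).1 * (Ubar k t).2) = 0

/-! ### Entropies and weak entropy solutions -/

/-- `λ = 1 / (γ - 1) - 1 / 2`. -/
def lam (γ : ℝ) : ℝ := 1 / (γ - 1) - 1 / 2

/-- `J_λ = ∫_{-1}^{1} (1 - z ^ 2) ^ λ dz`. -/
def jConst (γ : ℝ) : ℝ := ∫ z in (-1 : ℝ)..1, (1 - z ^ 2) ^ lam γ

/-- The kernel `χ(ρ, ξ)`, normalized by `∫ χ(ρ, ξ) dξ = ρ`. -/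
def chi (κ γ ρ ξ : ℝ) : ℝ :=
  aConst κ γ ^ (-(2 / (γ - 1))) / jConst γ *
    (max (aConst κ γ ^ 2 * ρ ^ (γ - 1) - ξ ^ 2) 0) ^ lam γ

/-- The weak entropy `η_S`. -/
def entropy (κ γ : ℝ) (S : ℝ → ℝ) (s : ℝ × ℝ) : ℝ :=
  ∫ v, chi κ γ s.1 (v - s.2) * S v

/-- The entropy flux `G_S`. -/
def entropyFlux (κ γ : ℝ) (S : ℝ → ℝ) (s : ℝ × ℝ) : ℝ :=
  ∫ v, ((1 - theta γ) * s.2 + theta γ * v) * chi κ γ s.1 (v - s.2) * S v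

/-- The momentum flux `ρ u ^ 2 + κ ρ ^ γ`. -/
def momentumFlux (κ γ : ℝ) (s : ℝ × ℝ) : ℝ := s.1 * s.2 ^ 2 + κ * s.1 ^ γ

/-- Smooth test functions with compact support in `Ω ⊆ ℝ_t × ℝ_x`. -/
def IsTest (Ω : Set (ℝ × ℝ)) (φ : ℝ × ℝ → ℝ) : Prop :=
  ContDiff ℝ ∞ φ ∧ HasCompactSupport φ ∧ tsupport φ ⊆ Ω

/-- `∬ (a ∂_t φ + b ∂_x φ) dt dx`. -/
def weakPairing (a b φ : ℝ × ℝ → ℝ) : ℝ :=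
  ∫ p, (a p * fderiv ℝ φ p (1, 0) + b p * fderiv ℝ φ p (0, 1))

/-- Weak entropy solutions of the isentropic gas equations in an open set `Ω ⊆ ℝ_t × ℝ_x`. The
entropy inequality is imposed for every convex `S` for which entropy and entropy flux are locally
integrable along the solution, so that the inequality makes sense. -/
structure IsWeakEntropySolution (κ γ : ℝ) (Ω : Set (ℝ × ℝ)) (U : ℝ → ℝ → ℝ × ℝ) : Prop where
  integrable_density : LocallyIntegrableOn (fun p : ℝ × ℝ => (U p.1 p.2).1) Ω
  integrable_momentum :
    LocallyIntegrableOn (fun p : ℝ × ℝ => (U p.1 p.2).1 * (U p.1 p.2).2) Ω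
  integrable_flux : LocallyIntegrableOn (fun p : ℝ × ℝ => momentumFlux κ γ (U p.1 p.2)) Ω
  mass : ∀ φ, IsTest Ω φ →
    weakPairing (fun p => (U p.1 p.2).1) (fun p => (U p.1 p.2).1 * (U p.1 p.2).2) φ = 0
  momentum : ∀ φ, IsTest Ω φ →
    weakPairing (fun p => (U p.1 p.2).1 * (U p.1 p.2).2)
      (fun p => momentumFlux κ γ (U p.1 p.2)) φ = 0
  entropy_le : ∀ S : ℝ → ℝ, ConvexOn ℝ univ S →
    LocallyIntegrableOn (fun p : ℝ × ℝ => entropy κ γ S (U p.1 p.2)) Ω →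
    LocallyIntegrableOn (fun p : ℝ × ℝ => entropyFlux κ γ S (U p.1 p.2)) Ω →
    ∀ φ, IsTest Ω φ → (∀ p, 0 ≤ φ p) →
      0 ≤ weakPairing (fun p => entropy κ γ S (U p.1 p.2))
        (fun p => entropyFlux κ γ S (U p.1 p.2)) φ

/-! ### The generalized Cauchy problem -/

/-- The time interval `[0, T]`, which is `[0, ∞)` for `T = ∞`. -/
def timeSet (T : EReal) : Set ℝ := {t | 0 ≤ t ∧ (t : EReal) ≤ T}

/-- `(0, T) × (0, ∞)`. -/
def spaceTime (T : EReal) : Set (ℝ × ℝ) := {p | 0 < p.1 ∧ (p.1 : EReal) < T ∧ 0 < p.2}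

/-- `U k t x = (ρ_k, u_k)(t, x)`, `k = 1, …, d`, is a solution on `[0, T]` of the generalized
Cauchy problem with initial data `Uhat k x`, artificial density `ρs t` and traces
`Ubar k t = (ρ_k, u_k)(t, 0+)`. The conserved quantities lie in `C([0, T], U0 + L¹(0, ∞))`, where
the constant states `U0 k` are given in the conserved quantities. -/
structure IsGeneralizedCauchySolution (κ γ : ℝ) {d : ℕ} (A : Fin d → ℝ) (T : EReal)
    (U0 : Fin d → ℝ × ℝ) (Uhat : Fin d → ℝ → ℝ × ℝ) (U : Fin d → ℝ → ℝ → ℝ × ℝ)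
    (ρs : ℝ → ℝ) (Ubar : Fin d → ℝ → ℝ × ℝ) : Prop where
  base_mem : ∀ k, U0 k ∈ D
  init_mem : ∀ k, ∀ᵐ x : ℝ, 0 < x → cons (Uhat k x) ∈ D
  init_integrable : ∀ k, IntegrableOn (fun x => cons (Uhat k x) - U0 k) (Ioi 0)
  mem : ∀ k, ∀ t ∈ timeSet T, ∀ᵐ x : ℝ, 0 < x → cons (U k t x) ∈ D
  integrable : ∀ k, ∀ t ∈ timeSet T, IntegrableOn (fun x => cons (U k t x) - U0 k) (Ioi 0)
  continuous : ∀ k, ∀ t₀ ∈ timeSet T,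
    Tendsto (fun t => eLpNorm (fun x => cons (U k t x) - cons (U k t₀ x)) 1
      (volume.restrict (Ioi 0))) (𝓝[timeSet T] t₀) (𝓝 0)
  weak : ∀ k, IsWeakEntropySolution κ γ (spaceTime T) (U k)
  trace : ∀ᵐ t : ℝ, 0 < t → (t : EReal) < T → ∀ k, HasTrace (U k t) (Ubar k t)
  /-- initial condition -/
  cp0 : ∀ k, ∀ᵐ x : ℝ, 0 < x → cons (U k 0 x) = cons (Uhat k x)
  /-- coupling condition -/
  cp1 : ∀ᵐ t : ℝ, 0 < t → (t : EReal) < T →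
    0 ≤ ρs t ∧ ∀ k, Ubar k t ∈ boundarySet κ γ (ρs t, 0)
  /-- conservation of mass -/
  cp2 : ∀ᵐ t : ℝ, 0 < t → (t : EReal) < T → ∑ k, A k * ((Ubar k t).1 * (Ubar k t).2) = 0

end Gas

end

namespace Gas

/-! The energy flux factors as `G = ρ u h`. If every junction trace satisfies `h ≤ h(ρ*, 0)` when `u
≥ 0` and `h ≥ h(ρ*, 0)` when `u ≤ 0`, then `ρ u h ≤ ρ u h(ρ*, 0)` whatever the sign of `u`. Summing
with weights `A k`, mass conservation annihilates the right-hand side. Both claims thus reduce to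
`EnthalpyOrdered`, a statement about one pipe.

It is checked wave by wave on Lax solutions with left state `(ρ*, 0)`. If the middle velocity is
positive, the trace lies on a 1-rarefaction and is at most sonic, and there `h` has dropped
(`enthalpyOrdered_of_rarefaction`). If it is nonpositive, the middle density is at least `ρ*`. A
trace in a 2-rarefaction is then denser still and has larger `h`. Only a 2-shock that has entered
the junction can lower the density; Rankine-Hugoniot and a trapezoidal bound still give larger `h`
behind it (`stagnationEnthalpy_le_of_shock`). -/

/-- The enthalpy comparison with the state `(ρs, 0)` which holds for boundary values. -/
def EnthalpyOrdered (κ γ ρs : ℝ) (s : ℝ × ℝ) : Prop :=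
  (0 ≤ s.2 → stagnationEnthalpy κ γ s ≤ stagnationEnthalpy κ γ (ρs, 0)) ∧
    (s.2 ≤ 0 → stagnationEnthalpy κ γ (ρs, 0) ≤ stagnationEnthalpy κ γ s)

/-! ### Constants, enthalpy and conserved quantities -/

theorem theta_pos {γ : ℝ} (hγ : 1 < γ) : 0 < theta γ := by
  unfold theta; linarith

theorem theta_mul_aConst {κ γ : ℝ} (hγ : 1 < γ) : theta γ * aConst κ γ = √(κ * γ) := by
  unfold theta aConst
  have : γ - 1 ≠ 0 := by linarith
  rw [mul_comm γ κ]
  field_simp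

theorem aConst_pos {κ γ : ℝ} (hκ : 0 < κ) (hγ : 1 < γ) : 0 < aConst κ γ := by
  unfold aConst
  have : 0 < γ - 1 := by linarith
  have : 0 < γ := by linarith
  positivity

theorem sqrt_mul_pos {κ γ : ℝ} (hκ : 0 < κ) (hγ : 1 < γ) : 0 < √(κ * γ) :=
  Real.sqrt_pos.2 (mul_pos hκ (by linarith))

theorem soundSpeed_pos {κ γ ρ : ℝ} (hκ : 0 < κ) (hγ : 1 < γ) (hρ : 0 < ρ) :
    0 < soundSpeed κ γ ρ :=
  mul_pos (sqrt_mul_pos hκ hγ) (Real.rpow_pos_of_pos hρ _)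

theorem soundSpeed_zero (κ : ℝ) {γ : ℝ} (hγ : 1 < γ) : soundSpeed κ γ 0 = 0 := by
  simp [soundSpeed, Real.zero_rpow (theta_pos hγ).ne']

theorem rpow_sub_one_eq_sq {γ ρ : ℝ} (hρ : 0 ≤ ρ) : ρ ^ (γ - 1) = (ρ ^ theta γ) ^ 2 := by
  rw [← Real.rpow_natCast, ← Real.rpow_mul hρ]
  congr 1
  simp [theta]

/-- The enthalpy in terms of `z = ρ ^ θ`. -/
theorem stagnationEnthalpy_eq {κ γ : ℝ} (hκ : 0 < κ) (hγ : 1 < γ) {s : ℝ × ℝ} (hs : 0 ≤ s.1) :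
    stagnationEnthalpy κ γ s =
      s.2 ^ 2 / 2 + theta γ * aConst κ γ ^ 2 / 2 * (s.1 ^ theta γ) ^ 2 := by
  have h : κ * γ = (theta γ * aConst κ γ) ^ 2 := by
    rw [theta_mul_aConst hγ, Real.sq_sqrt (mul_nonneg hκ.le (by linarith))]
  have hg : γ - 1 = 2 * theta γ := by unfold theta; ring
  have ht := (theta_pos hγ).ne'
  rw [stagnationEnthalpy, rpow_sub_one_eq_sq hs, h, hg]
  field_simp

theorem stagnationEnthalpy_mono {κ γ : ℝ} (hκ : 0 < κ) (hγ : 1 < γ) {ρ : ℝ} {s : ℝ × ℝ}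
    (hρ : 0 ≤ ρ) (h : ρ ≤ s.1) :
    stagnationEnthalpy κ γ (ρ, 0) ≤ stagnationEnthalpy κ γ s := by
  have h1 : ρ ^ (γ - 1) ≤ s.1 ^ (γ - 1) := Real.rpow_le_rpow hρ h (by linarith)
  have h2 : 0 ≤ κ * γ / (γ - 1) :=
    div_nonneg (mul_nonneg hκ.le (by linarith)) (by linarith)
  have := mul_le_mul_of_nonneg_left h1 h2
  have := sq_nonneg s.2
  simp only [stagnationEnthalpy]
  linarith

theorem energyFlux_eq {γ : ℝ} (κ : ℝ) (hγ : 1 < γ) {s : ℝ × ℝ} (hs : 0 ≤ s.1) :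
    energyFlux κ γ s = s.1 * s.2 * stagnationEnthalpy κ γ s := by
  have h : s.1 ^ γ = s.1 * s.1 ^ (γ - 1) := by
    rcases hs.eq_or_lt with h0 | h0
    · rw [← h0, Real.zero_rpow (by linarith), zero_mul]
    · rw [Real.rpow_sub_one h0.ne', mul_div_cancel₀ _ h0.ne']
  rw [energyFlux, stagnationEnthalpy, h]
  ring

theorem fst_nonneg_of_mem_D {s : ℝ × ℝ} (hs : s ∈ D) : 0 ≤ s.1 := by
  rcases hs with h | h
  · exact h.le
  · exact h.1.ge

theorem cons_injOn_D : InjOn cons D := by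
  rintro ⟨ρ, u⟩ hs ⟨ρ', u'⟩ hs' h
  obtain ⟨h1, h2⟩ := Prod.mk.inj h
  simp only at h1 h2
  subst h1
  rcases hs with h0 | ⟨h0, hu⟩
  · rw [mul_left_cancel₀ h0.ne' h2]
  · rcases hs' with h0' | ⟨-, hu'⟩
    · exact absurd h0 h0'.ne'
    · simp only at hu hu'
      rw [hu, hu']

theorem continuous_cons : Continuous cons := by
  unfold cons; fun_prop

/-! ### Rarefactions -/

/-- With `z = ρ ^ θ`, `y = ρs ^ θ`, `u = a (y - z)`, the enthalpy drop is `a² / 2 * (y - z) * (θ (y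
+ z) - (y - z))`. The subsonic bound `hc` reads `y - z ≤ θ z`, so both factors are nonnegative. -/
theorem enthalpyOrdered_of_rarefaction {κ γ : ℝ} (hκ : 0 < κ) (hγ : 1 < γ) {ρs : ℝ} {s : ℝ × ℝ}
    (hρs : 0 ≤ ρs) (hs : 0 < s.1) (hu : 0 < s.2)
    (hw : s.2 = aConst κ γ * ρs ^ theta γ - aConst κ γ * s.1 ^ theta γ)
    (hc : s.2 ≤ soundSpeed κ γ s.1) : EnthalpyOrdered κ γ ρs s := by
  refine ⟨fun _ => ?_, fun h => absurd hu h.not_gt⟩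
  rw [stagnationEnthalpy_eq hκ hγ hs.le, stagnationEnthalpy_eq hκ hγ (s := (ρs, 0)) hρs]
  rw [soundSpeed, ← theta_mul_aConst hγ] at hc
  have ha := aConst_pos hκ hγ
  have ht := theta_pos hγ
  have hz : 0 < s.1 ^ theta γ := Real.rpow_pos_of_pos hs _
  simp only
  generalize s.1 ^ theta γ = z at *
  generalize ρs ^ theta γ = y at *
  generalize aConst κ γ = a at *
  generalize theta γ = b at *
  have hy : z < y := by
    by_contra! h
    have := mul_le_mul_of_nonneg_left h ha.le
    linarith
  have hc' : y - z ≤ b * z := by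
    have : a * (y - z) ≤ a * (b * z) := by rw [hw] at hc; linarith
    exact le_of_mul_le_mul_left this ha
  have h1 : 0 ≤ (y - z) * (b * (y + z) - (y - z)) :=
    mul_nonneg (by linarith) (by nlinarith)
  have h2 := mul_nonneg (sq_nonneg a) h1
  rw [hw]
  nlinarith

/-- The density in a rarefaction fan, in terms of the power `ρ ^ θ`. -/
theorem fan_density_rpow {κ γ : ℝ} (hκ : 0 < κ) (hγ : 1 < γ) {w : ℝ} (hw : 0 ≤ w) :
    (aConst κ γ + √(κ * γ)) *
      ((w / (aConst κ γ + √(κ * γ))) ^ (1 / theta γ)) ^ theta γ = w := by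
  have h := add_pos (aConst_pos hκ hγ) (sqrt_mul_pos hκ hγ)
  rw [← Real.rpow_mul (div_nonneg hw h.le), one_div_mul_cancel (theta_pos hγ).ne',
    Real.rpow_one, mul_div_cancel₀ _ h.ne']

theorem continuous_fan1 (κ : ℝ) {γ : ℝ} (hγ : 1 < γ) (w : ℝ) : Continuous (fan1 κ γ w) := by
  have ht := theta_pos hγ
  have h : Continuous fun ξ : ℝ => ((w - ξ) / (aConst κ γ + √(κ * γ))) ^ (1 / theta γ) :=
    Continuous.rpow_const (by fun_prop) fun _ => Or.inr (by positivity)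
  refine h.prodMk (continuous_id.add (continuous_const.mul ?_))
  exact h.rpow_const fun _ => Or.inr ht.le

theorem continuous_fan2 (κ : ℝ) {γ : ℝ} (hγ : 1 < γ) (w : ℝ) : Continuous (fan2 κ γ w) := by
  have ht := theta_pos hγ
  have h : Continuous fun ξ : ℝ => ((ξ - w) / (aConst κ γ + √(κ * γ))) ^ (1 / theta γ) :=
    Continuous.rpow_const (by fun_prop) fun _ => Or.inr (by positivity)
  refine h.prodMk (continuous_id.sub (continuous_const.mul ?_))
  exact h.rpow_const fun _ => Or.inr ht.le

/-- The sonic state in the 1-rarefaction fan issuing from `(ρs, 0)`. -/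
theorem fan1_zero_spec {κ γ : ℝ} (hκ : 0 < κ) (hγ : 1 < γ) {ρs : ℝ} (hρs : 0 < ρs) :
    fan1 κ γ (omega2 κ γ (ρs, 0)) 0 ∈ D ∧
      EnthalpyOrdered κ γ ρs (fan1 κ γ (omega2 κ γ (ρs, 0)) 0) := by
  have hw : 0 < omega2 κ γ (ρs, 0) := by
    simpa [omega2] using mul_pos (aConst_pos hκ hγ) (Real.rpow_pos_of_pos hρs _)
  have hA := add_pos (aConst_pos hκ hγ) (sqrt_mul_pos hκ hγ)
  have hf := fan_density_rpow hκ hγ hw.le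
  have hpos : 0 < (omega2 κ γ (ρs, 0) / (aConst κ γ + √(κ * γ))) ^ (1 / theta γ) :=
    Real.rpow_pos_of_pos (div_pos hw hA) _
  simp only [fan1, sub_zero, zero_add]
  refine ⟨Or.inl hpos, enthalpyOrdered_of_rarefaction hκ hγ hρs.le hpos
    (soundSpeed_pos hκ hγ hpos) ?_ le_rfl⟩
  have : omega2 κ γ (ρs, 0) = aConst κ γ * ρs ^ theta γ := by simp [omega2]
  simp only [soundSpeed]
  linarith

theorem fan2_zero_spec {κ γ : ℝ} (hκ : 0 < κ) (hγ : 1 < γ) {w : ℝ} (hw : w ≤ 0) :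
    fan2 κ γ w 0 ∈ D ∧ (fan2 κ γ w 0).2 = -soundSpeed κ γ (fan2 κ γ w 0).1 ∧
      (aConst κ γ + √(κ * γ)) * (fan2 κ γ w 0).1 ^ theta γ = -w := by
  have hA := add_pos (aConst_pos hκ hγ) (sqrt_mul_pos hκ hγ)
  refine ⟨?_, by simp [fan2], ?_⟩
  · have h0 : 0 ≤ (fan2 κ γ w 0).1 :=
      Real.rpow_nonneg (div_nonneg (by linarith) hA.le) _
    rcases h0.eq_or_lt with h | h
    · refine Or.inr ⟨h.symm, ?_⟩
      change 0 - soundSpeed κ γ (fan2 κ γ w 0).1 = 0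
      rw [← h, soundSpeed_zero κ hγ, sub_zero]
    · exact Or.inl h
  · have := fan_density_rpow hκ hγ (w := -w) (by linarith)
    simpa [fan2] using this

/-! ### Shocks -/

theorem shockJump_pos {κ γ : ℝ} (hκ : 0 < κ) (hγ : 1 < γ) {ρ₀ ρ : ℝ} (h₀ : 0 < ρ₀)
    (h : ρ₀ < ρ) : 0 < shockJump κ γ ρ₀ ρ := by
  have h1 : ρ₀ ^ γ < ρ ^ γ := Real.rpow_lt_rpow h₀.le h (by linarith)
  exact Real.sqrt_pos.2 (div_pos (mul_pos (mul_pos hκ (sub_pos.2 h1)) (sub_pos.2 h))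
    (mul_pos (h₀.trans h) h₀))

/-- Bernoulli's inequality for `(x⁻¹) ^ (γ + 1)`, multiplied by `x ^ (γ + 1)`. -/
theorem add_one_mul_rpow_le {γ x : ℝ} (hγ : 0 ≤ γ) (hx : 0 < x) :
    (γ + 1) * x ^ γ ≤ γ * x ^ (γ + 1) + 1 := by
  have hb := one_add_mul_self_le_rpow_one_add (s := x⁻¹ - 1) (p := γ + 1)
    (by linarith [inv_pos.2 hx]) (by linarith)
  rw [add_sub_cancel, Real.inv_rpow hx.le] at hb
  have hp : 0 < x ^ (γ + 1) := Real.rpow_pos_of_pos hx _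
  have h := mul_le_mul_of_nonneg_right hb hp.le
  rw [inv_mul_cancel₀ hp.ne'] at h
  have hs : x ^ (γ + 1) * x⁻¹ = x ^ γ := by
    rw [Real.rpow_add_one hx.ne']
    field_simp
  calc (γ + 1) * x ^ γ = (γ + 1) * (x ^ (γ + 1) * x⁻¹) := by rw [hs]
    _ ≤ γ * x ^ (γ + 1) + 1 := by linarith

/-- The trapezoidal bound for `∫ p⁻ᵅ dp`, in dimensionless form. -/
theorem trapezoid_normalized {γ x : ℝ} (hγ : 1 < γ) (hx : 1 ≤ x) :
    γ / (γ - 1) * (x ^ (γ - 1) - 1) ≤ (x ^ γ - 1) * (x + 1) / (2 * x) := by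
  -- Right side minus left side. It vanishes at `1`, and its derivative is the Bernoulli gap of
  -- `add_one_mul_rpow_le` over `2 y²`.
  let f : ℝ → ℝ := fun y => (y ^ γ + y ^ (γ - 1) - 1 - y⁻¹) / 2 - γ / (γ - 1) * (y ^ (γ - 1) - 1)
  have hg : γ - 1 ≠ 0 := by linarith
  have hd : ∀ y : ℝ, 0 < y → HasDerivAt f
      ((γ * y ^ (γ - 1) + (γ - 1) * y ^ (γ - 1 - 1) - -(y ^ 2)⁻¹) / 2 -
        γ / (γ - 1) * ((γ - 1) * y ^ (γ - 1 - 1))) y := by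
    intro y hy
    have h1 := Real.hasDerivAt_rpow_const (x := y) (p := γ) (Or.inl hy.ne')
    have h2 := Real.hasDerivAt_rpow_const (x := y) (p := γ - 1) (Or.inl hy.ne')
    exact ((((h1.add h2).sub_const 1).sub (hasDerivAt_inv hy.ne')).div_const 2).sub
      ((h2.sub_const 1).const_mul _)
  have hmono : MonotoneOn f (Ici 1) := by
    refine monotoneOn_of_deriv_nonneg (convex_Ici 1)
      (fun y hy => (hd y (by linarith [mem_Ici.1 hy])).continuousAt.continuousWithinAt)
      (fun y hy => ?_) fun y hy => ?_
    · rw [interior_Ici, mem_Ioi] at hy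
      exact (hd y (by linarith)).differentiableAt.differentiableWithinAt
    · rw [interior_Ici, mem_Ioi] at hy
      have hy0 : 0 < y := by linarith
      rw [(hd y hy0).deriv]
      have hb := add_one_mul_rpow_le (γ := γ) (by linarith) hy0
      have e1 : y ^ (γ - 1) = y ^ γ / y := Real.rpow_sub_one hy0.ne' _
      have e2 : y ^ (γ - 1 - 1) = y ^ γ / y / y := by rw [Real.rpow_sub_one hy0.ne', e1]
      have e3 : y ^ (γ + 1) = y ^ γ * y := Real.rpow_add_one hy0.ne' _
      rw [e3] at hb
      have : (γ * y ^ (γ - 1) + (γ - 1) * y ^ (γ - 1 - 1) - -(y ^ 2)⁻¹) / 2 -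
          γ / (γ - 1) * ((γ - 1) * y ^ (γ - 1 - 1)) =
          (γ * (y ^ γ * y) + 1 - (γ + 1) * y ^ γ) / (2 * y ^ 2) := by
        rw [e1, e2]
        field_simp
        ring
      rw [this]
      exact div_nonneg (by linarith) (by positivity)
  have h := hmono (mem_Ici.2 le_rfl) (mem_Ici.2 hx) hx
  have h1 : f 1 = 0 := by simp [f]
  have hx0 : 0 < x := by linarith
  have h2 : (x ^ γ - 1) * (x + 1) / (2 * x) = (x ^ γ + x ^ (γ - 1) - 1 - x⁻¹) / 2 := by
    rw [Real.rpow_sub_one hx0.ne']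
    field_simp
    ring
  rw [h1] at h
  rw [h2]
  simp only [f] at h
  linarith

/-- Both sides are homogeneous of degree `γ - 1`, so `x = b / a` suffices. -/
theorem trapezoid {γ a b : ℝ} (hγ : 1 < γ) (ha : 0 < a) (hab : a ≤ b) :
    γ / (γ - 1) * (b ^ (γ - 1) - a ^ (γ - 1)) ≤
      (b ^ γ - a ^ γ) * (b + a) / (2 * (b * a)) := by
  have hb : 0 < b := ha.trans_le hab
  have h := trapezoid_normalized hγ ((one_le_div ha).2 hab)
  have hp : 0 < a ^ (γ - 1) := Real.rpow_pos_of_pos ha _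
  have hp' : 0 < a ^ γ := Real.rpow_pos_of_pos ha _
  rw [Real.div_rpow hb.le ha.le, Real.div_rpow hb.le ha.le] at h
  have h' := mul_le_mul_of_nonneg_right h hp.le
  have e1 : γ / (γ - 1) * (b ^ (γ - 1) / a ^ (γ - 1) - 1) * a ^ (γ - 1) =
      γ / (γ - 1) * (b ^ (γ - 1) - a ^ (γ - 1)) := by
    field_simp
  have e2 : (b ^ γ / a ^ γ - 1) * (b / a + 1) / (2 * (b / a)) * a ^ (γ - 1) =
      (b ^ γ - a ^ γ) * (b + a) / (2 * (b * a)) := by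
    rw [Real.rpow_sub_one ha.ne']
    field_simp
  rwa [e1, e2] at h'

/-- The stagnation enthalpy does not decrease across a 2-shock of non-positive speed. -/
theorem stagnationEnthalpy_le_of_shock {κ γ : ℝ} (hκ : 0 < κ) (hγ : 1 < γ) {m r : ℝ × ℝ}
    (hr : 0 < r.1) (hrm : r.1 < m.1) (hu : r.2 = m.2 - shockJump κ γ m.1 r.1)
    (hσ : shockSpeed m r ≤ 0) :
    stagnationEnthalpy κ γ m ≤ stagnationEnthalpy κ γ r := by
  have hm : 0 < m.1 := hr.trans hrm
  have hδ : 0 < m.1 - r.1 := sub_pos.2 hrm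
  have hp : r.1 ^ γ < m.1 ^ γ := Real.rpow_lt_rpow hr.le hrm (by linarith)
  have hJ0 : 0 ≤ shockJump κ γ m.1 r.1 := Real.sqrt_nonneg _
  have hJ2 : shockJump κ γ m.1 r.1 ^ 2 =
      κ * (m.1 ^ γ - r.1 ^ γ) * (m.1 - r.1) / (m.1 * r.1) := by
    rw [shockJump, Real.sq_sqrt]
    · ring
    · rw [show κ * (r.1 ^ γ - m.1 ^ γ) * (r.1 - m.1) = κ * (m.1 ^ γ - r.1 ^ γ) * (m.1 - r.1) by
        ring]
      exact div_nonneg (mul_nonneg (mul_nonneg hκ.le (by linarith)) hδ.le) (by positivity)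
  have ht := mul_le_mul_of_nonneg_left (trapezoid hγ hr hrm.le) hκ.le
  generalize shockJump κ γ m.1 r.1 = J at *
  -- Nonpositive shock speed means `m.1 * m.2 ≤ r.1 * r.2`. This bounds the cross term `-m.2 * J` of
  -- the kinetic energy below; with `J ^ 2 / 2` it gives exactly the trapezoidal expression in `e`.
  have hflux : r.1 * J ≤ -m.2 * (m.1 - r.1) := by
    have : m.1 * m.2 ≤ r.1 * r.2 := by
      by_contra! hlt
      have : 0 < shockSpeed m r := div_pos_of_neg_of_neg (by linarith) (by linarith)
      linarith
    rw [hu] at this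
    linarith
  have hum : r.1 * J ^ 2 / (m.1 - r.1) ≤ -m.2 * J := by
    rw [div_le_iff₀ hδ]
    have := mul_le_mul_of_nonneg_right hflux hJ0
    linarith
  have e : J ^ 2 / 2 + r.1 * J ^ 2 / (m.1 - r.1) =
      κ * ((m.1 ^ γ - r.1 ^ γ) * (m.1 + r.1) / (2 * (m.1 * r.1))) := by
    rw [hJ2]
    field_simp
    ring
  have e' : κ * γ / (γ - 1) * m.1 ^ (γ - 1) - κ * γ / (γ - 1) * r.1 ^ (γ - 1) =
      κ * (γ / (γ - 1) * (m.1 ^ (γ - 1) - r.1 ^ (γ - 1))) := by ring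
  have e'' : (m.2 - J) ^ 2 / 2 = m.2 ^ 2 / 2 + J ^ 2 / 2 + -m.2 * J := by ring
  rw [stagnationEnthalpy, stagnationEnthalpy, hu, e'']
  linarith

/-! ### Traces of Lax solutions -/

theorem tendsto_nhdsGT_zero_of_eq {W : ℝ → ℝ × ℝ} {s : ℝ × ℝ} {ε : ℝ} (hε : 0 < ε)
    (h : ∀ ξ, 0 < ξ → ξ < ε → W ξ = s) : Tendsto W (𝓝[>] 0) (𝓝 s) := by
  refine tendsto_const_nhds.congr' ?_
  filter_upwards [Ioo_mem_nhdsGT hε] with ξ hξ using (h ξ hξ.1 hξ.2).symm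

theorem tendsto_nhdsGT_zero_of_eq_fun {W f : ℝ → ℝ × ℝ} {ε : ℝ} (hε : 0 < ε)
    (hf : Continuous f) (h : ∀ ξ, 0 < ξ → ξ < ε → W ξ = f ξ) : Tendsto W (𝓝[>] 0) (𝓝 (f 0)) := by
  refine ((hf.tendsto 0).mono_left nhdsWithin_le_nhds).congr' ?_
  filter_upwards [Ioo_mem_nhdsGT hε] with ξ hξ using (h ξ hξ.1 hξ.2).symm

theorem twoWaveProfile_trace_of_pos {κ γ : ℝ} (hκ : 0 < κ) (hγ : 1 < γ) {ρs : ℝ} (hρs : 0 < ρs)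
    {m : ℝ × ℝ} (r : ℝ × ℝ) (hm : m ∈ laxCurve1 κ γ (ρs, 0)) (hu : 0 < m.2) :
    ∃ s ∈ D, Tendsto (twoWaveProfile κ γ (ρs, 0) m r) (𝓝[>] 0) (𝓝 s) ∧
      EnthalpyOrdered κ γ ρs s := by
  obtain ⟨hm0, ⟨hle, hm2⟩ | ⟨hlt, hm2⟩⟩ := hm
  · simp only [zero_add] at hle hm2
    have hl : lambda1 κ γ (ρs, 0) < 0 := by
      simpa [lambda1] using soundSpeed_pos hκ hγ hρs
    rcases le_or_gt (lambda1 κ γ m) 0 with h | h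
    · refine ⟨m, Or.inl hm0, tendsto_nhdsGT_zero_of_eq hu fun ξ h0 h1 => ?_,
        enthalpyOrdered_of_rarefaction hκ hγ hρs.le hm0 hu hm2 (sub_nonpos.1 h)⟩
      rw [twoWaveProfile, if_pos h1, wave1, if_pos hle, if_neg (by linarith),
        if_neg (by linarith)]
    · obtain ⟨hD, hE⟩ := fan1_zero_spec hκ hγ hρs
      refine ⟨_, hD, tendsto_nhdsGT_zero_of_eq_fun (lt_min hu h) (continuous_fan1 κ hγ _)
        fun ξ h0 h1 => ?_, hE⟩
      rw [twoWaveProfile, if_pos (h1.trans_le (min_le_left _ _)), wave1, if_pos hle,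
        if_neg (by linarith), if_pos (h1.trans_le (min_le_right _ _))]
  · have := shockJump_pos hκ hγ hρs hlt
    simp only [zero_sub] at hm2 hlt
    linarith

/-- From rest, rarefactions to smaller density accelerate the gas and shocks give negative velocity.
-/
theorem laxCurve1_spec_of_nonpos {κ γ : ℝ} (hκ : 0 < κ) (hγ : 1 < γ) {ρs : ℝ} (hρs : 0 < ρs)
    {m : ℝ × ℝ} (hm : m ∈ laxCurve1 κ γ (ρs, 0)) (hu : m.2 ≤ 0) :
    ρs ≤ m.1 ∧ (m.2 = 0 → m = (ρs, 0)) := by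
  obtain ⟨hm0, ⟨hle, hm2⟩ | ⟨hlt, hm2⟩⟩ := hm
  · simp only [zero_add] at hle hm2
    have : ρs ≤ m.1 := by
      by_contra! hlt
      have h1 := Real.rpow_lt_rpow hm0.le hlt (theta_pos hγ)
      have h2 := mul_lt_mul_of_pos_left h1 (aConst_pos hκ hγ)
      linarith
    exact ⟨this, fun h => Prod.ext (le_antisymm hle this) h⟩
  · have := shockJump_pos hκ hγ hρs hlt
    simp only [zero_sub] at hm2 hlt
    exact ⟨hlt.le, fun h => by linarith⟩

theorem twoWaveProfile_trace_of_nonpos {κ γ : ℝ} (hκ : 0 < κ) (hγ : 1 < γ) {ρs : ℝ}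
    (hρs : 0 < ρs) {m r : ℝ × ℝ} (hm : m ∈ laxCurve1 κ γ (ρs, 0)) (hu : m.2 ≤ 0)
    (hr : r ∈ laxCurve2 κ γ m) :
    ∃ s ∈ D, Tendsto (twoWaveProfile κ γ (ρs, 0) m r) (𝓝[>] 0) (𝓝 s) ∧
      EnthalpyOrdered κ γ ρs s := by
  obtain ⟨hρm, hm_eq⟩ := laxCurve1_spec_of_nonpos hκ hγ hρs hm hu
  have hm0 : 0 < m.1 := hρs.trans_le hρm
  have hW : ∀ ξ, 0 < ξ → twoWaveProfile κ γ (ρs, 0) m r ξ = wave2 κ γ m r ξ := fun ξ h =>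
    if_neg (by linarith)
  -- If `m.2 = 0`, then `m = (ρs, 0)` and the enthalpies agree.
  have hEm : EnthalpyOrdered κ γ ρs m := by
    refine ⟨fun h => ?_, fun _ => stagnationEnthalpy_mono hκ hγ hρs.le hρm⟩
    rw [hm_eq (le_antisymm hu h)]
  obtain ⟨hr0, ⟨hle, hr2⟩ | ⟨hlt, hr2⟩⟩ := hr
  · rcases lt_or_ge 0 (lambda2 κ γ m) with h | h
    · refine ⟨m, Or.inl hm0, tendsto_nhdsGT_zero_of_eq h fun ξ h0 h1 => ?_, hEm⟩
      rw [hW ξ h0, wave2, if_pos hle, if_pos h1.le]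
    rcases lt_or_ge 0 (lambda2 κ γ r) with h' | h'
    · have hw : omega1 κ γ r = m.2 - aConst κ γ * m.1 ^ theta γ := by
        rw [omega1, hr2]; ring
      have hz := mul_pos (aConst_pos hκ hγ) (Real.rpow_pos_of_pos hm0 (theta γ))
      obtain ⟨hD, hc, hf⟩ := fan2_zero_spec hκ hγ (w := omega1 κ γ r) (by linarith)
      have hA := add_pos (aConst_pos hκ hγ) (sqrt_mul_pos hκ hγ)
      -- Both states share `ω₁`, and `λ₂` is nonpositive at `m` but zero at the sonic state.
      have hρ : m.1 ≤ (fan2 κ γ (omega1 κ γ r) 0).1 := by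
        by_contra! hlt
        have h1 := Real.rpow_lt_rpow (fst_nonneg_of_mem_D hD) hlt (theta_pos hγ)
        have h2 := mul_lt_mul_of_pos_left h1 hA
        rw [hf, hw] at h2
        rw [lambda2, soundSpeed] at h
        linarith
      have hneg := soundSpeed_pos hκ hγ (hm0.trans_le hρ)
      refine ⟨_, hD, tendsto_nhdsGT_zero_of_eq_fun h' (continuous_fan2 κ hγ _)
        fun ξ h0 h1 => ?_, fun h0 => by linarith,
        fun _ => stagnationEnthalpy_mono hκ hγ hρs.le (hρm.trans hρ)⟩
      rw [hW ξ h0, wave2, if_pos hle, if_neg (by linarith), if_pos h1]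
    · have hneg := soundSpeed_pos hκ hγ hr0
      refine ⟨r, Or.inl hr0, tendsto_nhdsGT_zero_of_eq one_pos fun ξ h0 _ => ?_,
        fun h0 => ?_, fun _ => stagnationEnthalpy_mono hκ hγ hρs.le (hρm.trans hle)⟩
      · rw [hW ξ h0, wave2, if_pos hle, if_neg (by linarith), if_neg (by linarith)]
      · rw [lambda2] at h'
        linarith
  · rcases lt_or_ge 0 (shockSpeed m r) with h | h
    · refine ⟨m, Or.inl hm0, tendsto_nhdsGT_zero_of_eq h fun ξ h0 h1 => ?_, hEm⟩
      rw [hW ξ h0, wave2, if_neg hlt.not_ge, if_pos h1]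
    -- The jump is symmetric in the densities; its positivity makes `r.2 < 0`.
    · have hJ : 0 < shockJump κ γ m.1 r.1 := by
        have := shockJump_pos hκ hγ hr0 hlt
        rwa [shockJump, show κ * (m.1 ^ γ - r.1 ^ γ) * (m.1 - r.1) / (m.1 * r.1) =
          κ * (r.1 ^ γ - m.1 ^ γ) * (r.1 - m.1) / (r.1 * m.1) by ring] at this
      refine ⟨r, Or.inl hr0, tendsto_nhdsGT_zero_of_eq one_pos fun ξ h0 _ => ?_,
        fun h0 => by linarith, fun _ => (hEm.2 hu).trans
          (stagnationEnthalpy_le_of_shock hκ hγ hr0 hlt hr2 h)⟩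
      rw [hW ξ h0, wave2, if_neg hlt.not_ge, if_neg (by linarith)]

theorem enthalpyOrdered_zero_of_imp {κ γ : ℝ} (hκ : 0 < κ) (hγ : 1 < γ) {s : ℝ × ℝ} (hs : s ∈ D)
    (h : 0 ≤ s.2 → s = (0, 0)) : EnthalpyOrdered κ γ 0 s :=
  ⟨fun h0 => by rw [h h0], fun _ => stagnationEnthalpy_mono hκ hγ le_rfl (fst_nonneg_of_mem_D hs)⟩

/-- For `ρs > 0` the complete 1-fan straddles `ξ = 0`, since `λ₁ < 0 < ω₂`, and the trace is sonic.
For `ρs = 0` it is vacuum, the sonic state of the 2-fan, or `r`. -/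
theorem vacuumProfile_trace {κ γ : ℝ} (hκ : 0 < κ) (hγ : 1 < γ) {ρs : ℝ} (hρs : 0 ≤ ρs)
    (r : ℝ × ℝ) :
    ∃ s ∈ D, Tendsto (vacuumProfile κ γ (ρs, 0) r) (𝓝[>] 0) (𝓝 s) ∧
      EnthalpyOrdered κ γ ρs s := by
  rcases hρs.eq_or_lt with rfl | hρs
  · have hW : ∀ ξ, vacuumProfile κ γ (0, 0) r ξ = if 0 < r.1 ∧ omega1 κ γ r < ξ then
        if ξ < lambda2 κ γ r then fan2 κ γ (omega1 κ γ r) ξ else r else (0, 0) := fun ξ =>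
      if_neg (by simp)
    have hvac : ∀ ε > 0, (∀ ξ, 0 < ξ → ξ < ε → ¬(0 < r.1 ∧ omega1 κ γ r < ξ)) →
        ∃ s ∈ D, Tendsto (vacuumProfile κ γ (0, 0) r) (𝓝[>] 0) (𝓝 s) ∧
          EnthalpyOrdered κ γ 0 s := fun ε hε h => by
      have hD : ((0, 0) : ℝ × ℝ) ∈ D := Or.inr ⟨rfl, rfl⟩
      refine ⟨(0, 0), hD, tendsto_nhdsGT_zero_of_eq hε fun ξ h0 h1 => ?_,
        enthalpyOrdered_zero_of_imp hκ hγ hD fun _ => rfl⟩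
      rw [hW, if_neg (h ξ h0 h1)]
    rcases le_or_gt r.1 0 with hr | hr
    · exact hvac 1 one_pos fun ξ _ _ h => absurd h.1 hr.not_gt
    rcases lt_or_ge 0 (omega1 κ γ r) with hw | hw
    · exact hvac _ hw fun ξ _ h1 h => absurd h.2 h1.not_gt
    rcases lt_or_ge 0 (lambda2 κ γ r) with h | h
    · obtain ⟨hD, hc, -⟩ := fan2_zero_spec hκ hγ hw
      refine ⟨_, hD, tendsto_nhdsGT_zero_of_eq_fun h (continuous_fan2 κ hγ _)
        fun ξ h0 h1 => ?_, enthalpyOrdered_zero_of_imp hκ hγ hD fun h0 => ?_⟩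
      · rw [hW, if_pos ⟨hr, by linarith⟩, if_pos h1]
      · rcases hD with hD | hD
        · linarith [soundSpeed_pos hκ hγ hD]
        · exact Prod.ext hD.1 hD.2
    · have hD : r ∈ D := Or.inl hr
      refine ⟨r, hD, tendsto_nhdsGT_zero_of_eq one_pos fun ξ h0 _ => ?_,
        enthalpyOrdered_zero_of_imp hκ hγ hD fun h0 => ?_⟩
      · rw [hW, if_pos ⟨hr, by linarith⟩, if_neg (by linarith)]
      · rw [lambda2] at h
        linarith [soundSpeed_pos hκ hγ hr]
  · obtain ⟨hD, hE⟩ := fan1_zero_spec hκ hγ hρs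
    have hw : 0 < omega2 κ γ (ρs, 0) := by
      simpa [omega2] using mul_pos (aConst_pos hκ hγ) (Real.rpow_pos_of_pos hρs _)
    have hl : lambda1 κ γ (ρs, 0) < 0 := by
      simpa [lambda1] using soundSpeed_pos hκ hγ hρs
    refine ⟨_, hD, tendsto_nhdsGT_zero_of_eq_fun hw (continuous_fan1 κ hγ _)
      fun ξ h0 h1 => ?_, hE⟩
    rw [vacuumProfile, if_pos ⟨hρs, h1⟩, if_neg (by linarith)]

/-- A Lax solution with left state `(ρs, 0)` has a trace at `0+`, whose enthalpy is comparable
with that of `(ρs, 0)`. -/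
theorem IsLaxSolution.exists_trace {κ γ : ℝ} (hκ : 0 < κ) (hγ : 1 < γ) {ρs : ℝ} (hρs : 0 ≤ ρs)
    {r : ℝ × ℝ} {W : ℝ → ℝ × ℝ} (hW : IsLaxSolution κ γ (ρs, 0) r W) :
    ∃ s ∈ D, Tendsto W (𝓝[>] 0) (𝓝 s) ∧ EnthalpyOrdered κ γ ρs s := by
  rcases hW with ⟨hl, -, m, hm, hr, rfl⟩ | ⟨-, rfl⟩
  · rcases lt_or_ge 0 m.2 with hu | hu
    · exact twoWaveProfile_trace_of_pos hκ hγ hl r hm hu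
    · exact twoWaveProfile_trace_of_nonpos hκ hγ hl hm hu hr
  · exact vacuumProfile_trace hκ hγ hρs r

theorem enthalpyOrdered_of_mem_boundarySet {κ γ : ℝ} (hκ : 0 < κ) (hγ : 1 < γ) {ρs : ℝ}
    (hρs : 0 ≤ ρs) {s : ℝ × ℝ} (hs : s ∈ boundarySet κ γ (ρs, 0)) : EnthalpyOrdered κ γ ρs s := by
  obtain ⟨-, r, -, W, hW, hlim⟩ := hs
  obtain ⟨s', -, hlim', hE⟩ := hW.exists_trace hκ hγ hρs
  rwa [tendsto_nhds_unique hlim hlim']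

/-! ### Essential traces and summation over the pipes -/

instance neBot_nhdsGT_inf_ae : (𝓝[>] (0 : ℝ) ⊓ ae volume).NeBot := by
  rw [inf_neBot_iff]
  intro s hs t ht
  obtain ⟨ε, hε, hsub⟩ := mem_nhdsGT_iff_exists_Ioo_subset.1 hs
  by_contra h
  rw [not_nonempty_iff_eq_empty, ← disjoint_iff_inter_eq_empty] at h
  have h0 : volume (Ioo (0 : ℝ) ε) = 0 :=
    measure_mono_null (hsub.trans h.subset_compl_right) ht
  rw [Real.volume_Ioo, ENNReal.ofReal_eq_zero] at h0
  linarith [mem_Ioi.1 hε]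

/-- Limits of conserved quantities determine the state only within `D`, where vacuum has a fixed
velocity. -/
theorem HasTrace.eq_of_tendsto {f W : ℝ → ℝ × ℝ} {s s' : ℝ × ℝ} {t : ℝ} (hf : HasTrace f s)
    (ht : 0 < t) (hfW : ∀ᵐ x : ℝ, 0 < x → f x = W (x / t)) (hs' : s' ∈ D)
    (hW : Tendsto W (𝓝[>] 0) (𝓝 s')) : s = s' := by
  have hdiv : Tendsto (fun x : ℝ => x / t) (𝓝[>] 0) (𝓝[>] 0) := by
    refine tendsto_nhdsWithin_iff.2 ⟨?_, ?_⟩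
    · have : Tendsto (fun x : ℝ => x / t) (𝓝 0) (𝓝 (0 / t)) :=
        (continuous_id.div_const t).tendsto 0
      rw [zero_div] at this
      exact this.mono_left nhdsWithin_le_nhds
    · filter_upwards [self_mem_nhdsWithin] with x hx using div_pos hx ht
  have h1 : Tendsto (fun x => cons (W (x / t))) (𝓝[>] 0 ⊓ ae volume) (𝓝 (cons s')) :=
    ((continuous_cons.tendsto s').comp (hW.comp hdiv)).mono_left inf_le_left
  have h2 : (fun x => cons (f x)) =ᶠ[𝓝[>] 0 ⊓ ae volume] fun x => cons (W (x / t)) := by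
    filter_upwards [mem_inf_of_left self_mem_nhdsWithin, mem_inf_of_right hfW] with x hx hx'
    rw [hx' hx]
  exact cons_injOn_D hf.1 hs' (tendsto_nhds_unique (hf.2.congr' h2) h1)

theorem sum_energyFlux_nonpos {κ γ : ℝ} (hγ : 1 < γ) {d : ℕ} {A : Fin d → ℝ}
    (hA : ∀ k, 0 < A k) {ρs : ℝ} {s : Fin d → ℝ × ℝ} (hD : ∀ k, s k ∈ D)
    (hE : ∀ k, EnthalpyOrdered κ γ ρs (s k)) (hmass : ∑ k, A k * ((s k).1 * (s k).2) = 0) :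
    ∑ k, A k * energyFlux κ γ (s k) ≤ 0 := by
  calc ∑ k, A k * energyFlux κ γ (s k)
      ≤ ∑ k, A k * ((s k).1 * (s k).2) * stagnationEnthalpy κ γ (ρs, 0) := by
        refine Finset.sum_le_sum fun k _ => ?_
        have h0 := fst_nonneg_of_mem_D (hD k)
        rw [energyFlux_eq κ hγ h0, mul_assoc (A k)]
        refine mul_le_mul_of_nonneg_left ?_ (hA k).le
        rcases le_total 0 (s k).2 with h | h
        · exact mul_le_mul_of_nonneg_left ((hE k).1 h) (mul_nonneg h0 h)
        · exact mul_le_mul_of_nonpos_left ((hE k).2 h) (mul_nonpos_of_nonneg_of_nonpos h0 h)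
    _ = 0 := by rw [← Finset.sum_mul, hmass, zero_mul]

end Gas

theorem mainTheorem5 (κ γ : ℝ) (hκ : 0 < κ) (hγ₁ : 1 < γ) (hγ₃ : γ < 3)
    (d : ℕ) (A : Fin d → ℝ) (hA : ∀ k, 0 < A k) :
    (∀ (Uhat : Fin d → ℝ × ℝ) (U : Fin d → ℝ → ℝ → ℝ × ℝ) (ρs : ℝ)
      (Ubar : Fin d → ℝ → ℝ × ℝ),
      Gas.IsGeneralizedRiemannSolution κ γ A Uhat U ρs Ubar →
      ∀ᵐ t : ℝ, 0 < t →
        ∑ k, A k * Gas.energyFlux κ γ (Ubar k t) ≤ 0 ∧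
        ∀ k l, (Ubar l t).2 ≤ 0 → 0 ≤ (Ubar k t).2 →
          Gas.stagnationEnthalpy κ γ (Ubar k t) ≤ Gas.stagnationEnthalpy κ γ (ρs, 0) ∧
          Gas.stagnationEnthalpy κ γ (ρs, 0) ≤ Gas.stagnationEnthalpy κ γ (Ubar l t)) ∧
    (∀ (T : EReal), 0 < T →
      ∀ (U0 : Fin d → ℝ × ℝ) (Uhat : Fin d → ℝ → ℝ × ℝ) (U : Fin d → ℝ → ℝ → ℝ × ℝ)
        (ρs : ℝ → ℝ) (Ubar : Fin d → ℝ → ℝ × ℝ),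
      Gas.IsGeneralizedCauchySolution κ γ A T U0 Uhat U ρs Ubar →
      ∀ᵐ t : ℝ, 0 < t → (t : EReal) < T →
        ∑ k, A k * Gas.energyFlux κ γ (Ubar k t) ≤ 0 ∧
        ∀ k l, (Ubar l t).2 ≤ 0 → 0 ≤ (Ubar k t).2 →
          Gas.stagnationEnthalpy κ γ (Ubar k t) ≤ Gas.stagnationEnthalpy κ γ (ρs t, 0) ∧
          Gas.stagnationEnthalpy κ γ (ρs t, 0) ≤ Gas.stagnationEnthalpy κ γ (Ubar l t)) := by
  refine ⟨fun Uhat U ρs Ubar h => ?_, fun T _ U0 Uhat U ρs Ubar h => ?_⟩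
  · have hae : ∀ᵐ t : ℝ, 0 < t → ∀ k, Gas.EnthalpyOrdered κ γ ρs (Ubar k t) := by
      choose W hW hUW using h.rp1
      -- Fubini: equality for a.e. `(t, x)` gives it for a.e. `x` at a.e. time.
      have hfub : ∀ᵐ t : ℝ, ∀ k, ∀ᵐ x : ℝ, 0 < t → 0 < x → U k t x = W k (x / t) :=
        ae_all_iff.2 fun k => Measure.ae_ae_of_ae_prod (hUW k)
      filter_upwards [hfub, h.trace] with t ht htr ht0 k
      obtain ⟨s, hs, hlim, hE⟩ := (hW k).exists_trace hκ hγ₁ h.density_nonneg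
      have hx : ∀ᵐ x : ℝ, 0 < x → U k t x = W k (x / t) := (ht k).mono fun x hx => hx ht0
      rwa [(htr ht0 k).eq_of_tendsto ht0 hx hs hlim]
    filter_upwards [hae, h.trace, h.rp2] with t hE htr hmass ht0
    exact ⟨Gas.sum_energyFlux_nonpos hγ₁ hA (fun k => (htr ht0 k).1) (hE ht0) (hmass ht0),
      fun k l hl hk => ⟨(hE ht0 k).1 hk, (hE ht0 l).2 hl⟩⟩
  · filter_upwards [h.cp1, h.cp2] with t hV hmass ht0 htT
    obtain ⟨hρs, hV⟩ := hV ht0 htT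
    have hE := fun k => Gas.enthalpyOrdered_of_mem_boundarySet hκ hγ₁ hρs (hV k)
    exact ⟨Gas.sum_energyFlux_nonpos hγ₁ hA (fun k => (hV k).1) hE (hmass ht0 htT),
      fun k l hl hk => ⟨(hE k).1 hk, (hE l).2 hl⟩⟩
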